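/- For integers $n\ge 0$ and $k\ge 0$ let the Mahonian number $M_{n,k}$ be the number of permutations of $\{1,\dots,n\}$ with exactly $k$ inversions; equivalently, the number of integer solutions of $\eta_1+\dots+\eta_n=k$ with $0\le\eta_j<j$. For $\nu\ge n$ let the generalised Mahonian number $M^{\nu,\varkappa}_{n,k}$ be the number of integer solutions of $\eta_{n+1}+\dots+\eta_\nu=\varkappa-k$ with $0\le\eta_j<j$. For $q\in[0,\infty)$ put $[j]_q=1+q+\dots+q^{j-1}$ and $[n]_q!=\prod_{j=1}^n[j]_q$; for $q=\infty$ and $0\le k\le\binom n2$ the expression $q^k/[n]_q!$ is understood as its limit, which is $1$ if $k=\binom n2$ and $0$ otherwise. Let $\varkappa(\nu)$, $\nu=0,1,2,\dots$, be nonnegative integers with $\varkappa(\nu)\le\binom\nu2$ for all sufficiently large $\nu$. (i) If the ratios $M^{\nu,\varkappa(\nu)}_{n,k}/M_{\nu,\varkappa(\nu)}$ converge as $\nu\to\infty$ for all $n\ge1$ and $0\le k\le\binom n2$, then there is $q\in[0,\infty]$ such that the limit is $q^k/[n]_q!$ for all these $n,k$. (ii) The ratios converge for all $n\ge1$ and $0\le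 k\le\binom n2$ if and only if one of the following holds: (a) $\lim_{\nu\to\infty}\varkappa(\nu)/\nu=\frac{q}{1-q}$ for some $0\le q<1$; (b) $\lim_{\nu\to\infty}\bigl(\binom\nu2-\varkappa(\nu)\bigr)/\nu=\frac{q^{-1}}{1-q^{-1}}$ for some $1<q\le\infty$ (with $\infty^{-1}=0$); (c) $\varkappa(\nu)/\nu\to\infty$ and $\bigl(\binom\nu2-\varkappa(\nu)\bigr)/\nu\to\infty$. (iii) More precisely, for each $q\in[0,\infty]$ the ratios converge to $q^k/[n]_q!$ for all $n\ge1$ and $0\le k\le\binom n2$ if and only if (a) holds with this $q$ (when $q<1$), (b) holds with this $q$ (when $q>1$), (c) holds (when $q=1$). -/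

import Mathlib

open Filter Topology
open scoped ENNReal

/-- The number of inversions of a permutation `π`: pairs of positions `i < j` with
`π i > π j`. -/
def inversions {n : ℕ} (π : Equiv.Perm (Fin n)) : ℕ :=
  (Finset.univ.filter fun p : Fin n × Fin n => p.1 < p.2 ∧ π p.2 < π p.1).card

/-- The Mahonian number `M_{n,k}`: the number of permutations of `n` letters that have exactly `k`
inversions. -/
def mahonian (n k : ℕ) : ℕ :=
  (Finset.univ.filter fun π : Equiv.Perm (Fin n) => inversions π = k).card

/-- The generalised Mahonian number `M_{n,k}^{ν,κ}`: the number of integer solutions of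
`η_{n+1} + ⋯ + η_ν = κ - k` with `0 ≤ η_j < j`. The equation is written without subtraction, so
that there is no solution when `κ < k`. -/
def genMahonian (n k ν κ : ℕ) : ℕ :=
  Fintype.card
    {η : (j : ↥(Finset.Ioc n ν)) → Fin (j : ℕ) // k + ∑ j : ↥(Finset.Ioc n ν), (η j : ℕ) = κ}

/-- The ratio `M_{n,k}^{ν,κ} / M_{ν,κ}`. -/
noncomputable def mahonianRatio (n k ν κ : ℕ) : ℝ :=
  (genMahonian n k ν κ : ℝ) / (mahonian ν κ : ℝ)

/-- The `q`-factorial `[n]_q! = ∏_{j=1}^n [j]_q`, where `[j]_q = 1 + q + ⋯ + q^{j-1}`, that is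
`(1 - q^j) / (1 - q)` for `q ≠ 1`. -/
noncomputable def qFactorial (q : ℝ) (n : ℕ) : ℝ :=
  ∏ j ∈ Finset.Icc 1 n, ∑ i ∈ Finset.range j, q ^ i

/-- The Mallows mass `q^k / [n]_q!` of a permutation of `n` letters with `k` inversions, for
`q ∈ [0, ∞]`. For `q = ∞` the Mallows distribution is concentrated on the decreasing permutation,
the only one with `n.choose 2` inversions. -/
noncomputable def mallowsMass (q : ℝ≥0∞) (n k : ℕ) : ℝ :=
  if q = ∞ then (if k = n.choose 2 then 1 else 0) else q.toReal ^ k / qFactorial q.toReal n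

/-- The ratios `M_{n,k}^{ν,κ(ν)} / M_{ν,κ(ν)}` tend to `L n k` as `ν → ∞`, for all `n ≥ 1` and
`0 ≤ k ≤ n.choose 2`. -/
def RatiosTendTo (κ : ℕ → ℕ) (L : ℕ → ℕ → ℝ) : Prop :=
  ∀ n k : ℕ, 1 ≤ n → k ≤ n.choose 2 →
    Tendsto (fun ν : ℕ => mahonianRatio n k ν (κ ν)) atTop (𝓝 (L n k))

/-- `κ(ν) ∼ (q / (1 - q)) ν`, as convergence of the quotient by `ν` (for `q = 0` it reads
`κ(ν) = o(ν)`). Meant for `0 ≤ q < 1`. -/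
def LowRegime (κ : ℕ → ℕ) (q : ℝ≥0∞) : Prop :=
  Tendsto (fun ν : ℕ => (κ ν : ℝ) / (ν : ℝ)) atTop (𝓝 (q.toReal / (1 - q.toReal)))

/-- `ν.choose 2 - κ(ν) ∼ (q⁻¹ / (1 - q⁻¹)) ν`, as convergence of the quotient by `ν`, with
`∞⁻¹ = 0` (for `q = ∞` it reads `ν.choose 2 - κ(ν) = o(ν)`). Meant for `1 < q ≤ ∞`. -/
def HighRegime (κ : ℕ → ℕ) (q : ℝ≥0∞) : Prop :=
  Tendsto (fun ν : ℕ => ((ν.choose 2 : ℝ) - (κ ν : ℝ)) / (ν : ℝ)) atTop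
    (𝓝 ((q⁻¹).toReal / (1 - (q⁻¹).toReal)))

/-- Both `κ(ν)` and `ν.choose 2 - κ(ν)` grow faster than linearly. -/
def SuperlinearRegime (κ : ℕ → ℕ) : Prop :=
  Tendsto (fun ν : ℕ => (κ ν : ℝ) / (ν : ℝ)) atTop atTop ∧
    Tendsto (fun ν : ℕ => ((ν.choose 2 : ℝ) - (κ ν : ℝ)) / (ν : ℝ)) atTop atTop

/-!
The generating function of the permutations of `n` letters by inversions is `[n]_q!`, and
`M_{n,k}^{ν,κ}` is the coefficient of `q^(κ - k)` in `P = ∏_{n < j ≤ ν} [j]_q`. The identity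
`(1 - q) [j]_q = 1 - q^j` turns the derivative of `P` into a recursion for its coefficients
`a_m`, namely `(m + 1) a_{m+1} = (ν - n + m) a_m - (corrections)`. Dropping the corrections gives
`a_m / a_{m+1} ≥ (m + 1) / (ν - n + m)`, and by induction on `m` they are at most `a_m / (1 - ρ)^2`
as long as the coefficients grow with ratio at least `ρ⁻¹`. So if `κ / ν → q / (1 - q)`, consecutive
ratios `M_{n,k}^{ν,κ} / M_{ν,κ}` are asymptotically in geometric progression with quotient `q`, and
`∑_k M_{n,k} M_{n,k}^{ν,κ} = M_{ν,κ}` normalises the progression. The symmetry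
`κ ↦ (ν choose 2) - κ` gives the other linear regime, and combined with the lower bound it gives
quotient `1` in the superlinear one.

Conversely, along every ultrafilter finer than `ν → ∞` one of the regimes holds by compactness, and
its parameter is recovered from the limit `1 / (1 + q)` of the single ratio with `n = 2`, `k = 0`.
-/

section QProducts

open Polynomial

/-- The `q`-number `[j] = 1 + q + ⋯ + q^(j - 1)` as a polynomial in `q` over `R`. -/
noncomputable def qNumber (R : Type*) [CommSemiring R] (j : ℕ) : R[X] :=
  ∑ i ∈ Finset.range j, X ^ i

/-- The product of the `q`-numbers `[j]` over `j ∈ s`, as a polynomial in `q` over `R`. For `s` an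
interval of integers its coefficients are the (generalised) Mahonian numbers. -/
noncomputable def qProduct (R : Type*) [CommSemiring R] (s : Finset ℕ) : R[X] :=
  ∏ j ∈ s, qNumber R j

lemma choose_two_succ (n : ℕ) : (n + 1).choose 2 = n + n.choose 2 := by
  rw [Nat.choose_succ_succ' n 1, one_add_one_eq_two, Nat.choose_one_right]

section CommSemiring

variable {R : Type*} [CommSemiring R]

lemma coeff_qNumber (j i : ℕ) : (qNumber R j).coeff i = if i < j then 1 else 0 := by
  simp [qNumber, coeff_X_pow]

lemma natDegree_qNumber_succ_le (n : ℕ) : (qNumber R (n + 1)).natDegree ≤ n :=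
  natDegree_le_iff_coeff_eq_zero.2 fun i hi => by rw [coeff_qNumber, if_neg (by omega)]

lemma qProduct_eq_mul_erase {s : Finset ℕ} {j : ℕ} (hj : j ∈ s) :
    qProduct R s = qNumber R j * qProduct R (s.erase j) :=
  (Finset.mul_prod_erase s (qNumber R) hj).symm

lemma qProduct_Icc_succ (n : ℕ) :
    qProduct R (Finset.Icc 1 (n + 1)) = qNumber R (n + 1) * qProduct R (Finset.Icc 1 n) := by
  rw [qProduct, Finset.prod_Icc_succ_top (by omega), mul_comm, qProduct]

lemma natDegree_qProduct_Icc_le (n : ℕ) :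
    (qProduct R (Finset.Icc 1 n)).natDegree ≤ n.choose 2 := by
  induction n with
  | zero => simp [qProduct]
  | succ n ih =>
    rw [qProduct_Icc_succ, choose_two_succ]
    exact natDegree_mul_le_of_le (natDegree_qNumber_succ_le n) ih

end CommSemiring

lemma eval_qProduct_Icc (q : ℝ) (n : ℕ) :
    (qProduct ℝ (Finset.Icc 1 n)).eval q = qFactorial q n := by
  simp [qProduct, qNumber, qFactorial, eval_prod, eval_finsetSum]

section OrderedSemiring

variable {R : Type*} [CommSemiring R] [PartialOrder R] [IsOrderedRing R]

lemma coeff_qNumber_nonneg (j i : ℕ) : 0 ≤ (qNumber R j).coeff i := by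
  rw [coeff_qNumber]
  split_ifs
  exacts [zero_le_one, le_rfl]

lemma coeff_qProduct_nonneg (s : Finset ℕ) (m : ℕ) : 0 ≤ (qProduct R s).coeff m := by
  induction s using Finset.induction_on generalizing m with
  | empty =>
    rw [qProduct, Finset.prod_empty, coeff_one]
    split_ifs
    exacts [zero_le_one, le_rfl]
  | insert j s hj ih =>
    rw [qProduct, Finset.prod_insert hj, coeff_mul]
    exact Finset.sum_nonneg fun p _ => mul_nonneg (coeff_qNumber_nonneg _ _) (ih _)

lemma coeff_qProduct_erase_le {s : Finset ℕ} {j : ℕ} (hj : j ∈ s) (hj0 : 0 < j) (m : ℕ) :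
    (qProduct R (s.erase j)).coeff m ≤ (qProduct R s).coeff m := by
  have hterm : (qNumber R j).coeff 0 * (qProduct R (s.erase j)).coeff m
      = (qProduct R (s.erase j)).coeff m := by
    rw [coeff_qNumber, if_pos hj0, one_mul]
  rw [qProduct_eq_mul_erase hj, coeff_mul, ← hterm]
  exact Finset.single_le_sum
    (f := fun p : ℕ × ℕ => (qNumber R j).coeff p.1 * (qProduct R (s.erase j)).coeff p.2)
    (fun p _ => mul_nonneg (coeff_qNumber_nonneg _ _) (coeff_qProduct_nonneg _ _))
    (a := (0, m)) (by simp)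

end OrderedSemiring

lemma coeff_qProduct_Icc_pos {R : Type*} [CommSemiring R] [PartialOrder R] [IsStrictOrderedRing R]
    {n k : ℕ} (hk : k ≤ n.choose 2) : 0 < (qProduct R (Finset.Icc 1 n)).coeff k := by
  induction n generalizing k with
  | zero =>
    obtain rfl : k = 0 := by simpa using hk
    simp [qProduct]
  | succ n ih =>
    rw [choose_two_succ] at hk
    have hterm : (qNumber R (n + 1)).coeff (k - min k (n.choose 2)) = 1 := by
      rw [coeff_qNumber, if_pos (by omega)]
    rw [qProduct_Icc_succ, coeff_mul]
    refine Finset.sum_pos'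
      (fun p _ => mul_nonneg (coeff_qNumber_nonneg _ _) (coeff_qProduct_nonneg _ _))
      ⟨(k - min k (n.choose 2), min k (n.choose 2)), by simp, ?_⟩
    rw [hterm, one_mul]
    exact ih (min_le_right _ _)

section CommRing

variable {R : Type*} [CommRing R]

lemma one_sub_X_mul_derivative_qNumber (j : ℕ) :
    (1 - X) * derivative (qNumber R j) = qNumber R j - C (j : R) * X ^ (j - 1) := by
  have h : (1 - X) * qNumber R j = 1 - X ^ j := mul_neg_geom_sum X j
  have h' := congrArg derivative h
  simp only [derivative_mul, derivative_sub, derivative_one, derivative_X, derivative_X_pow] at h'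
  linear_combination h'

lemma one_sub_X_mul_derivative_qProduct (s : Finset ℕ) :
    (1 - X) * derivative (qProduct R s) = C (s.card : R) * qProduct R s
      - ∑ j ∈ s, C (j : R) * (qProduct R (s.erase j) * X ^ (j - 1)) := by
  have hfactor : ∀ j ∈ s, (1 - X) * ((∏ i ∈ s.erase j, qNumber R i) * derivative (qNumber R j))
      = qProduct R s - C (j : R) * (qProduct R (s.erase j) * X ^ (j - 1)) := by
    intro j hj
    rw [qProduct_eq_mul_erase hj, mul_left_comm, one_sub_X_mul_derivative_qNumber, ← qProduct]
    ring
  rw [qProduct, derivative_prod_finset, Finset.mul_sum, Finset.sum_congr rfl hfactor,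
    Finset.sum_sub_distrib]
  simp [qProduct]

lemma succ_mul_coeff_qProduct_succ (s : Finset ℕ) (m : ℕ) :
    (m + 1 : R) * (qProduct R s).coeff (m + 1) = (s.card + m : R) * (qProduct R s).coeff m
      - ∑ j ∈ s, (j : R) * (qProduct R (s.erase j) * X ^ (j - 1)).coeff m := by
  have h := congrArg (coeff · m) (one_sub_X_mul_derivative_qProduct (R := R) s)
  simp only [sub_mul, one_mul, coeff_sub, coeff_C_mul, finsetSum_coeff, coeff_derivative] at h
  have hX : (X * derivative (qProduct R s)).coeff m = m * (qProduct R s).coeff m := by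
    cases m with
    | zero => simp
    | succ m => rw [coeff_X_mul, coeff_derivative]; push_cast; ring
  rw [hX] at h
  linear_combination h

lemma succ_mul_coeff_qProduct_succ_le [PartialOrder R] [IsOrderedRing R] (s : Finset ℕ) (m : ℕ) :
    (m + 1 : R) * (qProduct R s).coeff (m + 1) ≤ (s.card + m : R) * (qProduct R s).coeff m := by
  rw [succ_mul_coeff_qProduct_succ, sub_le_self_iff]
  refine Finset.sum_nonneg fun j _ => mul_nonneg (Nat.cast_nonneg _) ?_
  rw [coeff_mul_X_pow']
  split_ifs
  exacts [coeff_qProduct_nonneg _ _, le_rfl]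

end CommRing

lemma sum_mul_coeff_qProduct_erase_le {s : Finset ℕ} {ρ : ℝ} (hρ : 0 ≤ ρ) {m : ℕ}
    (h : ∀ i < m, (qProduct ℝ s).coeff i ≤ ρ * (qProduct ℝ s).coeff (i + 1)) :
    ∑ j ∈ s, (j : ℝ) * (qProduct ℝ (s.erase j) * X ^ (j - 1)).coeff m
      ≤ (∑ j ∈ s, (j : ℝ) * ρ ^ (j - 1)) * (qProduct ℝ s).coeff m := by
  have hpow : ∀ i ≤ m, (qProduct ℝ s).coeff (m - i) ≤ ρ ^ i * (qProduct ℝ s).coeff m := by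
    intro i hi
    refine le_geom (u := fun i => (qProduct ℝ s).coeff (m - i)) hρ i fun k hk => ?_
    have := h (m - (k + 1)) (by omega)
    rwa [show m - (k + 1) + 1 = m - k by omega] at this
  rw [Finset.sum_mul]
  refine Finset.sum_le_sum fun j hj => ?_
  rcases j.eq_zero_or_pos with rfl | hj0
  · simp
  rw [mul_assoc, coeff_mul_X_pow']
  gcongr
  split_ifs with hjm
  · exact (coeff_qProduct_erase_le hj hj0 _).trans (hpow _ hjm)
  · exact mul_nonneg (pow_nonneg hρ _) (coeff_qProduct_nonneg _ _)

lemma coeff_qProduct_le_mul_succ {s : Finset ℕ} {ρ : ℝ} (hρ0 : 0 ≤ ρ) (hρ1 : ρ ≤ 1) {m : ℕ}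
    (hm : (m + 1 : ℝ) ≤ ρ * (s.card + m - ∑ j ∈ s, (j : ℝ) * ρ ^ (j - 1))) :
    (qProduct ℝ s).coeff m ≤ ρ * (qProduct ℝ s).coeff (m + 1) := by
  induction m using Nat.strong_induction_on with
  | _ m ih =>
    set c := ∑ j ∈ s, (j : ℝ) * ρ ^ (j - 1)
    have hgrowth : ∀ i < m, (qProduct ℝ s).coeff i ≤ ρ * (qProduct ℝ s).coeff (i + 1) := by
      intro i hi
      refine ih i hi ?_
      have him : (i : ℝ) ≤ m := by exact_mod_cast hi.le
      nlinarith
    have hrec : (s.card + m - c) * (qProduct ℝ s).coeff m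
        ≤ (m + 1) * (qProduct ℝ s).coeff (m + 1) := by
      rw [succ_mul_coeff_qProduct_succ]
      linarith [sum_mul_coeff_qProduct_erase_le hρ0 hgrowth]
    refine le_of_mul_le_mul_left ?_ (by positivity : (0 : ℝ) < m + 1)
    calc (m + 1 : ℝ) * (qProduct ℝ s).coeff m
        ≤ ρ * (s.card + m - c) * (qProduct ℝ s).coeff m :=
          mul_le_mul_of_nonneg_right hm (coeff_qProduct_nonneg s m)
      _ = ρ * ((s.card + m - c) * (qProduct ℝ s).coeff m) := mul_assoc _ _ _
      _ ≤ ρ * ((m + 1) * (qProduct ℝ s).coeff (m + 1)) := mul_le_mul_of_nonneg_left hrec hρ0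
      _ = (m + 1) * (ρ * (qProduct ℝ s).coeff (m + 1)) := mul_left_comm _ _ _

end QProducts

lemma sum_mul_pow_pred_le {ρ : ℝ} (hρ0 : 0 < ρ) (hρ1 : ρ < 1) (s : Finset ℕ) :
    ∑ j ∈ s, (j : ℝ) * ρ ^ (j - 1) ≤ ((1 - ρ) ^ 2)⁻¹ := by
  have hρ : ‖ρ‖ < 1 := by rwa [Real.norm_of_nonneg hρ0.le]
  have hterm : ∀ j : ℕ, (j : ℝ) * ρ ^ j / ρ = j * ρ ^ (j - 1) := by
    rintro (_ | j)
    · simp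
    · rw [pow_succ, Nat.add_sub_cancel]
      field_simp
  have hsum := (hasSum_coe_mul_geometric_of_norm_lt_one hρ).div_const ρ
  simp only [hterm, div_div_cancel_left' hρ0.ne'] at hsum
  exact sum_le_hasSum s (fun j _ => by positivity) hsum

section Counting

open Polynomial

/-- The permutation with first value `p` whose other values are in the same relative order as
those of `σ`. -/
def permCons {n : ℕ} (p : Fin (n + 1)) (σ : Equiv.Perm (Fin n)) : Equiv.Perm (Fin (n + 1)) :=
  (Equiv.Perm.decomposeFin.symm (0, σ)).trans p.cycleRange.symm

@[simp] lemma permCons_zero {n : ℕ} (p : Fin (n + 1)) (σ : Equiv.Perm (Fin n)) :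
    permCons p σ 0 = p := by
  simp [permCons]

@[simp] lemma permCons_succ {n : ℕ} (p : Fin (n + 1)) (σ : Equiv.Perm (Fin n)) (i : Fin n) :
    permCons p σ i.succ = p.succAbove (σ i) := by
  simp [permCons]

lemma permCons_bijective (n : ℕ) :
    Function.Bijective fun x : Fin (n + 1) × Equiv.Perm (Fin n) => permCons x.1 x.2 := by
  rw [Fintype.bijective_iff_injective_and_card]
  refine ⟨?_, by simp [Fintype.card_perm, Nat.factorial_succ]⟩
  rintro ⟨p, σ⟩ ⟨p', σ'⟩ h
  obtain rfl : p = p' := by simpa using DFunLike.congr_fun h 0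
  obtain rfl : σ = σ' := Equiv.ext fun i => by simpa using DFunLike.congr_fun h i.succ
  rfl

lemma inversions_eq_sum {n : ℕ} (π : Equiv.Perm (Fin n)) :
    inversions π = ∑ i, ∑ j, if i < j ∧ π j < π i then 1 else 0 := by
  rw [inversions, Finset.card_filter, Fintype.sum_prod_type]

lemma sum_castSucc_lt {n : ℕ} (p : Fin (n + 1)) :
    ∑ i : Fin n, (if i.castSucc < p then 1 else 0) = (p : ℕ) := by
  simp only [Fin.lt_def, Fin.val_castSucc]
  rw [Fin.sum_univ_eq_sum_range (fun i => if i < (p : ℕ) then 1 else 0), ← Finset.card_filter]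
  have hfilter : (Finset.range n).filter (· < (p : ℕ)) = Finset.range p := by
    ext i
    simp only [Finset.mem_filter, Finset.mem_range]
    omega
  rw [hfilter, Finset.card_range]

lemma inversions_permCons {n : ℕ} (p : Fin (n + 1)) (σ : Equiv.Perm (Fin n)) :
    inversions (permCons p σ) = p + inversions σ := by
  rw [inversions_eq_sum, inversions_eq_sum, Fin.sum_univ_succ]
  congr 1
  · rw [Fin.sum_univ_succ]
    simp only [lt_self_iff_false, false_and, if_false, zero_add, Fin.succ_pos, true_and,
      permCons_zero, permCons_succ, Fin.succAbove_lt_iff_castSucc_lt]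
    rw [Equiv.sum_comp σ (fun i => if i.castSucc < p then 1 else 0), sum_castSucc_lt]
  · refine Finset.sum_congr rfl fun i _ => ?_
    rw [Fin.sum_univ_succ]
    simp [Fin.succAbove_lt_succAbove_iff]

section GeneratingFunctions

variable {R : Type*} [CommSemiring R]

lemma sum_X_pow_inversions (n : ℕ) :
    ∑ π : Equiv.Perm (Fin n), (X : R[X]) ^ inversions π = qProduct R (Finset.Icc 1 n) := by
  induction n with
  | zero => simp [qProduct, inversions]
  | succ n ih =>
    rw [qProduct_Icc_succ, ← ih, ← Equiv.sum_comp (Equiv.ofBijective _ (permCons_bijective n)),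
      Fintype.sum_prod_type, qNumber, ← Fin.sum_univ_eq_sum_range (fun i => (X : R[X]) ^ i),
      Finset.sum_mul_sum]
    simp [inversions_permCons, pow_add]

lemma cast_mahonian (n k : ℕ) : (mahonian n k : R) = (qProduct R (Finset.Icc 1 n)).coeff k := by
  rw [← sum_X_pow_inversions, finsetSum_coeff, mahonian, Finset.card_filter]
  push_cast
  simp only [coeff_X_pow, eq_comm]

lemma qProduct_eq_sum_X_pow (s : Finset ℕ) :
    qProduct R s = ∑ η : (j : ↥s) → Fin (j : ℕ), X ^ (∑ j, (η j : ℕ)) := by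
  rw [qProduct, ← Finset.prod_coe_sort]
  simp only [qNumber, ← Fin.sum_univ_eq_sum_range (fun i => (X : R[X]) ^ i),
    ← Finset.prod_pow_eq_pow_sum]
  rw [Finset.prod_univ_sum, Fintype.piFinset_univ]

lemma cast_genMahonian (n k ν κ : ℕ) :
    (genMahonian n k ν κ : R) = (qProduct R (Finset.Ioc n ν) * X ^ k).coeff κ := by
  rw [qProduct_eq_sum_X_pow, Finset.sum_mul, finsetSum_coeff, genMahonian, Fintype.card_subtype,
    Finset.card_filter]
  push_cast
  simp only [← pow_add, coeff_X_pow, eq_comm, add_comm]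

lemma cast_genMahonian_add (n k ν m : ℕ) :
    (genMahonian n k ν (k + m) : R) = (qProduct R (Finset.Ioc n ν)).coeff m := by
  rw [cast_genMahonian, add_comm, coeff_mul_X_pow]

end GeneratingFunctions

lemma genMahonian_eq_zero_of_lt {n k ν κ : ℕ} (h : κ < k) : genMahonian n k ν κ = 0 := by
  rw [← Nat.cast_id (genMahonian n k ν κ), cast_genMahonian, coeff_mul_X_pow', if_neg h.not_ge]

lemma genMahonian_zero_zero (ν κ : ℕ) : genMahonian 0 0 ν κ = mahonian ν κ := by
  rw [← Nat.cast_id (genMahonian 0 0 ν κ), ← Nat.cast_id (mahonian ν κ), cast_mahonian,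
    cast_genMahonian, pow_zero, mul_one]
  rfl

lemma mahonian_pos {n k : ℕ} (hk : k ≤ n.choose 2) : 0 < mahonian n k := by
  rw [← Nat.cast_id (mahonian n k), cast_mahonian]
  exact coeff_qProduct_Icc_pos hk

lemma sum_mahonian_mul_genMahonian {n ν : ℕ} (h : n ≤ ν) (κ : ℕ) :
    ∑ k ∈ Finset.range (n.choose 2 + 1), mahonian n k * genMahonian n k ν κ = mahonian ν κ := by
  have hmul : qProduct ℕ (Finset.Icc 1 ν)
      = qProduct ℕ (Finset.Icc 1 n) * qProduct ℕ (Finset.Ioc n ν) :=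
    (Finset.prod_Ioc_consecutive (qNumber ℕ) (Nat.zero_le n) h).symm
  rw [← Nat.cast_id (mahonian ν κ), cast_mahonian, hmul,
    as_sum_range' _ _ (Nat.lt_succ_of_le (natDegree_qProduct_Icc_le n)), Finset.sum_mul,
    finsetSum_coeff]
  refine Finset.sum_congr rfl fun k _ => ?_
  rw [← cast_mahonian, ← C_mul_X_pow_eq_monomial, mul_assoc, coeff_C_mul, mul_comm (X ^ k),
    ← cast_genMahonian, Nat.cast_id, Nat.cast_id]

lemma sum_mahonian_mul_pow (q : ℝ) (n : ℕ) :
    ∑ k ∈ Finset.range (n.choose 2 + 1), (mahonian n k : ℝ) * q ^ k = qFactorial q n := by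
  rw [← eval_qProduct_Icc, eval_eq_sum_range' (Nat.lt_succ_of_le (natDegree_qProduct_Icc_le n))]
  simp only [cast_mahonian]

lemma choose_two_add_sum_Ioc_pred {n ν : ℕ} (h : n ≤ ν) :
    n.choose 2 + ∑ j ∈ Finset.Ioc n ν, (j - 1) = ν.choose 2 := by
  induction ν, h using Nat.le_induction with
  | base => simp
  | succ ν h ih =>
    rw [Finset.sum_Ioc_succ_top (by omega), ← add_assoc, ih, choose_two_succ, Nat.add_sub_cancel,
      add_comm]

lemma genMahonian_reflect {n k ν κ : ℕ} (h : n ≤ ν) (hk : k ≤ n.choose 2)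
    (hκ : κ ≤ ν.choose 2) :
    genMahonian n (n.choose 2 - k) ν (ν.choose 2 - κ) = genMahonian n k ν κ := by
  refine Fintype.card_congr (Equiv.subtypeEquiv (Equiv.piCongrRight fun j => Fin.revPerm) ?_)
  intro η
  have hsum : ∑ j : ↥(Finset.Ioc n ν), (η j : ℕ) + ∑ j : ↥(Finset.Ioc n ν), ((η j).rev : ℕ)
      = ∑ j ∈ Finset.Ioc n ν, (j - 1) := by
    rw [← Finset.sum_add_distrib, ← Finset.sum_coe_sort (Finset.Ioc n ν) fun j => j - 1]
    refine Finset.sum_congr rfl fun j _ => ?_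
    rw [Fin.val_rev]
    omega
  have := choose_two_add_sum_Ioc_pred h
  simp only [Equiv.piCongrRight_apply, Pi.map_apply, Fin.revPerm_apply]
  omega

lemma mahonian_reflect {ν κ : ℕ} (hκ : κ ≤ ν.choose 2) :
    mahonian ν (ν.choose 2 - κ) = mahonian ν κ := by
  rw [← genMahonian_zero_zero, ← genMahonian_zero_zero]
  exact genMahonian_reflect ν.zero_le (Nat.zero_le _) hκ

lemma mul_genMahonian_le_succ {n k ν κ : ℕ} {ρ : ℝ} (hν : n + k + 2 ≤ ν)
    (hρ : ρ * ((ν : ℝ) - n + (κ - k) - 1) ≤ κ - k) :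
    ρ * genMahonian n k ν κ ≤ genMahonian n (k + 1) ν κ := by
  have hν' : (n : ℝ) + k + 2 ≤ ν := by exact_mod_cast hν
  have hpos : 0 < (ν : ℝ) - n + (κ - k) - 1 := by linarith [Nat.cast_nonneg (α := ℝ) κ]
  have hρ' : ρ ≤ (κ - k) / ((ν : ℝ) - n + (κ - k) - 1) := (le_div_iff₀ hpos).2 hρ
  rcases le_or_gt κ k with hκ | hκ
  · have hρ0 : ρ ≤ 0 :=
      hρ'.trans (div_nonpos_of_nonpos_of_nonneg (sub_nonpos.2 (by exact_mod_cast hκ)) hpos.le)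
    exact (mul_nonpos_of_nonpos_of_nonneg hρ0 (Nat.cast_nonneg _)).trans (Nat.cast_nonneg _)
  · obtain ⟨m, rfl⟩ := Nat.exists_eq_add_of_le (Nat.succ_le_of_lt hκ)
    have hrec := succ_mul_coeff_qProduct_succ_le (R := ℝ) (Finset.Ioc n ν) m
    rw [← cast_genMahonian_add n k ν, ← cast_genMahonian_add n (k + 1) ν, Nat.card_Ioc,
      Nat.cast_sub (by omega), show k + (m + 1) = k + 1 + m by omega] at hrec
    refine (mul_le_mul_of_nonneg_right hρ' (Nat.cast_nonneg _)).trans ?_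
    rw [div_mul_eq_mul_div, div_le_iff₀ hpos]
    push_cast
    linarith

lemma genMahonian_succ_le_mul {n k ν κ : ℕ} {ρ : ℝ} (hρ0 : 0 < ρ) (hρ1 : ρ < 1) (h : n ≤ ν)
    (hκ : (κ : ℝ) - k ≤ ρ * (ν - n + (κ - k) - 1 - ((1 - ρ) ^ 2)⁻¹)) :
    (genMahonian n (k + 1) ν κ : ℝ) ≤ ρ * genMahonian n k ν κ := by
  rcases Nat.lt_or_ge κ (k + 1) with hk | hk
  · rw [genMahonian_eq_zero_of_lt hk, Nat.cast_zero]
    positivity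
  · obtain ⟨m, rfl⟩ := Nat.exists_eq_add_of_le hk
    rw [cast_genMahonian_add, add_assoc k 1 m, cast_genMahonian_add, add_comm 1 m]
    refine coeff_qProduct_le_mul_succ hρ0.le hρ1.le ?_
    rw [Nat.card_Ioc, Nat.cast_sub h]
    push_cast at hκ
    calc (m + 1 : ℝ) ≤ ρ * (ν - n + m - ((1 - ρ) ^ 2)⁻¹) := by linarith
      _ ≤ _ := by gcongr; exact sum_mul_pow_pred_le hρ0 hρ1 _

end Counting

section MahonianRatio

lemma mahonianRatio_nonneg (n k ν κ : ℕ) : 0 ≤ mahonianRatio n k ν κ := by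
  unfold mahonianRatio
  positivity

lemma sum_mahonian_mul_mahonianRatio {n ν κ : ℕ} (h : n ≤ ν) (hκ : κ ≤ ν.choose 2) :
    ∑ k ∈ Finset.range (n.choose 2 + 1), (mahonian n k : ℝ) * mahonianRatio n k ν κ = 1 := by
  simp only [mahonianRatio, ← mul_div_assoc]
  rw [← Finset.sum_div, div_eq_one_iff_eq (Nat.cast_ne_zero.2 (mahonian_pos hκ).ne')]
  exact_mod_cast sum_mahonian_mul_genMahonian h κ

lemma mahonianRatio_le_one {n k ν κ : ℕ} (h : n ≤ ν) (hk : k ≤ n.choose 2)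
    (hκ : κ ≤ ν.choose 2) : mahonianRatio n k ν κ ≤ 1 :=
  calc mahonianRatio n k ν κ ≤ mahonian n k * mahonianRatio n k ν κ :=
        le_mul_of_one_le_left (mahonianRatio_nonneg _ _ _ _) (by exact_mod_cast mahonian_pos hk)
    _ ≤ ∑ k ∈ Finset.range (n.choose 2 + 1), (mahonian n k : ℝ) * mahonianRatio n k ν κ :=
        Finset.single_le_sum (f := fun k => (mahonian n k : ℝ) * mahonianRatio n k ν κ)
          (fun k _ => mul_nonneg (Nat.cast_nonneg _) (mahonianRatio_nonneg _ _ _ _))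
          (Finset.mem_range_succ_iff.2 hk)
    _ = 1 := sum_mahonian_mul_mahonianRatio h hκ

lemma mahonianRatio_reflect {n k ν κ : ℕ} (h : n ≤ ν) (hk : k ≤ n.choose 2)
    (hκ : κ ≤ ν.choose 2) :
    mahonianRatio n (n.choose 2 - k) ν (ν.choose 2 - κ) = mahonianRatio n k ν κ := by
  rw [mahonianRatio, mahonianRatio, genMahonian_reflect h hk hκ, mahonian_reflect hκ]

end MahonianRatio

section MallowsMass

lemma qFactorial_succ (q : ℝ) (n : ℕ) :
    qFactorial q (n + 1) = qFactorial q n * ∑ i ∈ Finset.range (n + 1), q ^ i :=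
  Finset.prod_Icc_succ_top (by omega) _

lemma qFactorial_pos {q : ℝ} (hq : 0 ≤ q) (n : ℕ) : 0 < qFactorial q n :=
  Finset.prod_pos fun _ hj =>
    geom_sum_pos hq (Nat.one_le_iff_ne_zero.1 (Finset.mem_Icc.1 hj).1)

lemma qFactorial_zero_left (n : ℕ) : qFactorial 0 n = 1 :=
  Finset.prod_eq_one fun j hj => by
    rw [zero_geom_sum, if_neg (Nat.one_le_iff_ne_zero.1 (Finset.mem_Icc.1 hj).1)]

lemma qFactorial_inv {q : ℝ} (hq : q ≠ 0) (n : ℕ) :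
    q ^ n.choose 2 * qFactorial q⁻¹ n = qFactorial q n := by
  induction n with
  | zero => simp [qFactorial]
  | succ n ih =>
    have hsum : q ^ n * ∑ i ∈ Finset.range (n + 1), q⁻¹ ^ i
        = ∑ i ∈ Finset.range (n + 1), q ^ i := by
      rw [← Finset.sum_range_reflect, Finset.mul_sum]
      refine Finset.sum_congr rfl fun i hi => ?_
      rw [Nat.add_sub_cancel, inv_pow, ← pow_sub₀ q hq (Nat.sub_le n i),
        Nat.sub_sub_self (Finset.mem_range_succ_iff.1 hi)]
    rw [qFactorial_succ, qFactorial_succ, ← ih, ← hsum, choose_two_succ, pow_add]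
    ring

lemma mallowsMass_of_ne_top {q : ℝ≥0∞} (hq : q ≠ ∞) (n k : ℕ) :
    mallowsMass q n k = q.toReal ^ k / qFactorial q.toReal n :=
  if_neg hq

lemma mallowsMass_top (n k : ℕ) : mallowsMass ∞ n k = if k = n.choose 2 then 1 else 0 :=
  if_pos rfl

lemma mallowsMass_zero_left (n k : ℕ) : mallowsMass 0 n k = if k = 0 then 1 else 0 := by
  rw [mallowsMass_of_ne_top ENNReal.zero_ne_top, ENNReal.toReal_zero, qFactorial_zero_left,
    div_one, zero_pow_eq]

lemma mallowsMass_inv (q : ℝ≥0∞) {n k : ℕ} (hk : k ≤ n.choose 2) :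
    mallowsMass q⁻¹ n (n.choose 2 - k) = mallowsMass q n k := by
  rcases eq_or_ne q 0 with rfl | hq0
  · rw [ENNReal.inv_zero, mallowsMass_top, mallowsMass_zero_left]
    exact if_congr (by omega) rfl rfl
  rcases eq_or_ne q ∞ with rfl | hq
  · rw [ENNReal.inv_top, mallowsMass_top, mallowsMass_zero_left]
    exact if_congr (by omega) rfl rfl
  have hr : q.toReal ≠ 0 := ENNReal.toReal_ne_zero.2 ⟨hq0, hq⟩
  rw [mallowsMass_of_ne_top (ENNReal.inv_ne_top.2 hq0), mallowsMass_of_ne_top hq,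
    ENNReal.toReal_inv, ← qFactorial_inv hr, inv_pow, ← pow_sub_mul_pow q.toReal hk]
  field_simp

lemma mallowsMass_two_zero (q : ℝ≥0∞) : mallowsMass q 2 0 = ((1 + q)⁻¹).toReal := by
  rcases eq_or_ne q ∞ with rfl | hq
  · simp [mallowsMass_top]
  · have h : qFactorial q.toReal 2 = 1 + q.toReal := by
      rw [qFactorial_succ, qFactorial_succ]
      simp [qFactorial, Finset.sum_range_succ]
    rw [mallowsMass_of_ne_top hq, h, pow_zero, one_div, ENNReal.toReal_inv,
      ENNReal.toReal_add ENNReal.one_ne_top hq, ENNReal.toReal_one]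

lemma mallowsMass_two_zero_injective : Function.Injective fun q => mallowsMass q 2 0 := by
  intro q q' h
  have hne_top : ∀ x : ℝ≥0∞, (1 + x)⁻¹ ≠ ∞ := fun x => ENNReal.inv_ne_top.2 (by simp)
  simp only [mallowsMass_two_zero] at h
  rw [ENNReal.toReal_eq_toReal_iff' (hne_top q) (hne_top q'), inv_inj] at h
  exact (ENNReal.add_right_inj ENNReal.one_ne_top).1 h

end MallowsMass

section Limits

lemma tendsto_sub_mul_zero {ι : Type*} {l : Filter ι} {r s : ι → ℝ} {q : ℝ}
    (hr : ∀ᶠ ν in l, r ν ≤ 1) (hlow : ∀ᶠ ρ in 𝓝[<] q, ∀ᶠ ν in l, ρ * r ν ≤ s ν)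
    (hup : ∀ᶠ ρ in 𝓝[>] q, ∀ᶠ ν in l, s ν ≤ ρ * r ν) :
    Tendsto (fun ν => s ν - q * r ν) l (𝓝 0) := by
  rw [Metric.tendsto_nhds]
  intro ε hε
  obtain ⟨ρ, hρ, hρε, hρq⟩ := (hlow.and (Ioo_mem_nhdsLT (sub_lt_self q hε))).exists
  obtain ⟨ρ', hρ', hqρ', hρε'⟩ := (hup.and (Ioo_mem_nhdsGT (lt_add_of_pos_right q hε))).exists
  filter_upwards [hr, hρ, hρ'] with ν h1 hl hu
  rw [Real.dist_eq, sub_zero, abs_lt]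
  have hlow' := mul_le_of_le_one_right (sub_nonneg.2 hρq.le) h1
  have hup' := mul_le_of_le_one_right (sub_nonneg.2 hqρ'.le) h1
  constructor <;> linarith

lemma tendsto_geometric_of_sum_eq_one {ι : Type*} {l : Filter ι} {D : ℕ} {M : ℕ → ℝ}
    {R : ℕ → ι → ℝ} {q : ℝ} (hS : ∑ k ∈ Finset.range (D + 1), M k * q ^ k ≠ 0)
    (hsum : ∀ᶠ ν in l, ∑ k ∈ Finset.range (D + 1), M k * R k ν = 1)
    (hstep : ∀ k < D, Tendsto (fun ν => R (k + 1) ν - q * R k ν) l (𝓝 0)) {k : ℕ} (hk : k ≤ D) :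
    Tendsto (R k) l (𝓝 (q ^ k / ∑ i ∈ Finset.range (D + 1), M i * q ^ i)) := by
  have hdiff : ∀ k ≤ D, Tendsto (fun ν => R k ν - q ^ k * R 0 ν) l (𝓝 0) := by
    intro k
    induction k with
    | zero => intro _; simpa using tendsto_const_nhds
    | succ k ih =>
      intro hk
      have := (hstep k hk).add ((ih (by omega)).const_mul q)
      rw [mul_zero, add_zero] at this
      exact this.congr fun ν => by ring
  have hzero : Tendsto (R 0) l (𝓝 (∑ i ∈ Finset.range (D + 1), M i * q ^ i)⁻¹) := by
    have herror : Tendsto (fun ν => ∑ k ∈ Finset.range (D + 1), M k * (R k ν - q ^ k * R 0 ν)) l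
        (𝓝 (∑ k ∈ Finset.range (D + 1), M k * 0)) :=
      tendsto_finsetSum _ fun k hk => (hdiff k (Finset.mem_range_succ_iff.1 hk)).const_mul _
    have hquot := (herror.const_sub 1).div_const (∑ i ∈ Finset.range (D + 1), M i * q ^ i)
    simp only [mul_zero, Finset.sum_const_zero, sub_zero, one_div] at hquot
    refine hquot.congr' ?_
    filter_upwards [hsum] with ν hν
    rw [div_eq_iff hS, Finset.mul_sum, ← hν, ← Finset.sum_sub_distrib]
    exact Finset.sum_congr rfl fun k _ => by ring
  have := (hdiff k hk).add (hzero.const_mul (q ^ k))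
  rw [zero_add, ← div_eq_mul_inv] at this
  exact this.congr fun ν => by ring

lemma eventually_le_mul_natCast {δ : ℝ} (hδ : 0 < δ) (a : ℝ) : ∀ᶠ ν : ℕ in atTop, a ≤ δ * ν :=
  (tendsto_natCast_atTop_atTop.const_mul_atTop hδ).eventually_ge_atTop a

lemma div_one_sub_lt_div_one_sub {x y : ℝ} (hxy : x < y) (hy : y < 1) :
    x / (1 - x) < y / (1 - y) := by
  rw [div_lt_div_iff₀ (by linarith) (by linarith)]
  linarith

lemma exists_tendsto_or_tendsto_atTop {ι : Type*} (g : Ultrafilter ι) {u : ι → ℝ}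
    (hu : ∀ᶠ ν in (g : Filter ι), 0 ≤ u ν) :
    (∃ t, 0 ≤ t ∧ Tendsto u g (𝓝 t)) ∨ Tendsto u g atTop := by
  have hlim : Tendsto (fun ν => ENNReal.ofReal (u ν)) g
      (𝓝 (g.map fun ν => ENNReal.ofReal (u ν)).lim) :=
    (g.map fun ν => ENNReal.ofReal (u ν)).le_nhds_lim
  set t := (g.map fun ν => ENNReal.ofReal (u ν)).lim
  by_cases ht : t = ∞
  · rw [ht] at hlim
    exact Or.inr (ENNReal.tendsto_ofReal_nhds_top.1 hlim)
  · refine Or.inl ⟨t.toReal, ENNReal.toReal_nonneg,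
      ((ENNReal.tendsto_toReal ht).comp hlim).congr' ?_⟩
    filter_upwards [hu] with ν hν
    exact ENNReal.toReal_ofReal hν

lemma exists_lt_one_div_one_sub_eq {t : ℝ} (ht : 0 ≤ t) :
    ∃ q : ℝ≥0∞, q < 1 ∧ q.toReal / (1 - q.toReal) = t := by
  have hpos : 0 < 1 + t := by positivity
  refine ⟨ENNReal.ofReal (t / (1 + t)), ?_, ?_⟩
  · rw [ENNReal.ofReal_lt_one, div_lt_one hpos]
    linarith
  · rw [ENNReal.toReal_ofReal (by positivity)]
    field_simp
    ring

end Limits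

section Convergence

variable {l : Filter ℕ} {κ : ℕ → ℕ} {n k : ℕ}

lemma eventually_mahonianRatio_le_one (hl : l ≤ atTop) (hκ : ∀ᶠ ν in l, κ ν ≤ ν.choose 2)
    (hk : k ≤ n.choose 2) : ∀ᶠ ν in l, mahonianRatio n k ν (κ ν) ≤ 1 := by
  filter_upwards [hκ, hl (eventually_ge_atTop n)] with ν hκν hν
  exact mahonianRatio_le_one hν hk hκν

lemma eventually_mahonianRatio_reflect (hl : l ≤ atTop) (hκ : ∀ᶠ ν in l, κ ν ≤ ν.choose 2)
    (hk : k ≤ n.choose 2) :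
    ∀ᶠ ν in l, mahonianRatio n (n.choose 2 - k) ν (ν.choose 2 - κ ν)
      = mahonianRatio n k ν (κ ν) := by
  filter_upwards [hκ, hl (eventually_ge_atTop n)] with ν hκν hν
  exact mahonianRatio_reflect hν hk hκν

lemma eventually_mul_mahonianRatio_le_succ (hl : l ≤ atTop) {ρ t : ℝ} (hρ1 : ρ < 1)
    (hρt : ρ / (1 - ρ) < t) (h : ∀ᶠ ν : ℕ in l, t ≤ (κ ν : ℝ) / ν) (n k : ℕ) :
    ∀ᶠ ν in l, ρ * mahonianRatio n k ν (κ ν) ≤ mahonianRatio n (k + 1) ν (κ ν) := by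
  have hδ : 0 < (1 - ρ) * t - ρ := by
    rw [div_lt_iff₀ (sub_pos.2 hρ1)] at hρt
    linarith
  filter_upwards [h, hl (eventually_ge_atTop (n + k + 2)),
    hl (eventually_le_mul_natCast hδ ((1 - ρ) * k - ρ * (n + 1)))] with ν hκ hν hlarge
  have hν0 : (0 : ℝ) < ν := by exact_mod_cast (by omega : 0 < ν)
  rw [le_div_iff₀ hν0] at hκ
  rw [mahonianRatio, mahonianRatio, ← mul_div_assoc]
  gcongr
  refine mul_genMahonian_le_succ hν ?_
  linarith [mul_le_mul_of_nonneg_left hκ (sub_pos.2 hρ1).le]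

lemma eventually_mahonianRatio_succ_le_mul (hl : l ≤ atTop) {ρ t : ℝ} (hρ0 : 0 < ρ) (hρ1 : ρ < 1)
    (htρ : t < ρ / (1 - ρ)) (h : ∀ᶠ ν : ℕ in l, (κ ν : ℝ) / ν ≤ t) (n k : ℕ) :
    ∀ᶠ ν in l, mahonianRatio n (k + 1) ν (κ ν) ≤ ρ * mahonianRatio n k ν (κ ν) := by
  have hδ : 0 < ρ - (1 - ρ) * t := by
    rw [lt_div_iff₀ (sub_pos.2 hρ1)] at htρ
    linarith
  filter_upwards [h, hl (eventually_ge_atTop (n + 1)),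
    hl (eventually_le_mul_natCast hδ (ρ * (n + 1 + ((1 - ρ) ^ 2)⁻¹) - (1 - ρ) * k))]
    with ν hκ hν hlarge
  have hν0 : (0 : ℝ) < ν := by exact_mod_cast (by omega : 0 < ν)
  rw [div_le_iff₀ hν0] at hκ
  rw [mahonianRatio, mahonianRatio, ← mul_div_assoc]
  gcongr
  refine genMahonian_succ_le_mul hρ0 hρ1 (by omega) ?_
  linarith [mul_le_mul_of_nonneg_left hκ (sub_pos.2 hρ1).le]

lemma tendsto_mahonianRatio_of_step (hl : l ≤ atTop) (hκ : ∀ᶠ ν in l, κ ν ≤ ν.choose 2) {q : ℝ}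
    (hq : 0 ≤ q)
    (hlow : ∀ k < n.choose 2, ∀ᶠ ρ in 𝓝[<] q, ∀ᶠ ν in l,
      ρ * mahonianRatio n k ν (κ ν) ≤ mahonianRatio n (k + 1) ν (κ ν))
    (hup : ∀ k < n.choose 2, ∀ᶠ ρ in 𝓝[>] q, ∀ᶠ ν in l,
      mahonianRatio n (k + 1) ν (κ ν) ≤ ρ * mahonianRatio n k ν (κ ν))
    (hk : k ≤ n.choose 2) :
    Tendsto (fun ν => mahonianRatio n k ν (κ ν)) l (𝓝 (q ^ k / qFactorial q n)) := by
  rw [← sum_mahonian_mul_pow]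
  refine tendsto_geometric_of_sum_eq_one (M := fun k => (mahonian n k : ℝ))
    (R := fun k ν => mahonianRatio n k ν (κ ν)) ?_ ?_ (fun k hk => ?_) hk
  · rw [sum_mahonian_mul_pow]
    exact (qFactorial_pos hq n).ne'
  · filter_upwards [hκ, hl (eventually_ge_atTop n)] with ν hκν hν
    exact sum_mahonian_mul_mahonianRatio hν hκν
  · exact tendsto_sub_mul_zero (eventually_mahonianRatio_le_one hl hκ hk.le) (hlow k hk) (hup k hk)

lemma tendsto_mahonianRatio_of_linear (hl : l ≤ atTop) (hκ : ∀ᶠ ν in l, κ ν ≤ ν.choose 2)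
    {q : ℝ} (hq0 : 0 ≤ q) (hq1 : q < 1)
    (h : Tendsto (fun ν : ℕ => (κ ν : ℝ) / ν) l (𝓝 (q / (1 - q)))) (hk : k ≤ n.choose 2) :
    Tendsto (fun ν => mahonianRatio n k ν (κ ν)) l (𝓝 (q ^ k / qFactorial q n)) := by
  refine tendsto_mahonianRatio_of_step hl hκ hq0 (fun k _ => ?_) (fun k _ => ?_) hk
  · filter_upwards [self_mem_nhdsWithin] with ρ hρq
    obtain ⟨t, hρt, htq⟩ := exists_between (div_one_sub_lt_div_one_sub hρq hq1)
    exact eventually_mul_mahonianRatio_le_succ hl (hρq.trans hq1) hρt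
      (h.eventually_const_le htq) n k
  · filter_upwards [Ioo_mem_nhdsGT hq1] with ρ ⟨hqρ, hρ1⟩
    obtain ⟨t, hqt, htρ⟩ := exists_between (div_one_sub_lt_div_one_sub hqρ hρ1)
    exact eventually_mahonianRatio_succ_le_mul hl (hq0.trans_lt hqρ) hρ1 htρ
      (h.eventually_le_const hqt) n k

lemma eventually_mul_mahonianRatio_le_succ_of_atTop (hl : l ≤ atTop)
    (h : Tendsto (fun ν : ℕ => (κ ν : ℝ) / ν) l atTop) {ρ : ℝ} (hρ : ρ < 1) (n k : ℕ) :
    ∀ᶠ ν in l, ρ * mahonianRatio n k ν (κ ν) ≤ mahonianRatio n (k + 1) ν (κ ν) :=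
  eventually_mul_mahonianRatio_le_succ hl hρ (lt_add_one _) (h.eventually_ge_atTop _) n k

lemma tendsto_mahonianRatio_of_superlinear (hl : l ≤ atTop)
    (hκ : ∀ᶠ ν in l, κ ν ≤ ν.choose 2)
    (h : Tendsto (fun ν : ℕ => (κ ν : ℝ) / ν) l atTop)
    (h' : Tendsto (fun ν : ℕ => ((ν.choose 2 - κ ν : ℕ) : ℝ) / ν) l atTop)
    (hk : k ≤ n.choose 2) :
    Tendsto (fun ν => mahonianRatio n k ν (κ ν)) l (𝓝 (1 ^ k / qFactorial 1 n)) := by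
  refine tendsto_mahonianRatio_of_step hl hκ zero_le_one (fun k _ => ?_) (fun k hk => ?_) hk
  · filter_upwards [self_mem_nhdsWithin] with ρ hρ
    exact eventually_mul_mahonianRatio_le_succ_of_atTop hl h hρ n k
  · filter_upwards [self_mem_nhdsWithin] with ρ hρ
    have hρ0 : 0 < ρ := zero_lt_one.trans hρ
    filter_upwards [eventually_mul_mahonianRatio_le_succ_of_atTop hl h' (inv_lt_one_of_one_lt₀ hρ)
        n (n.choose 2 - (k + 1)),
      eventually_mahonianRatio_reflect hl hκ hk.le, eventually_mahonianRatio_reflect hl hκ hk]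
      with ν hstep hreflect hreflect_succ
    rwa [show n.choose 2 - (k + 1) + 1 = n.choose 2 - k by omega, hreflect, hreflect_succ,
      inv_mul_le_iff₀ hρ0] at hstep

end Convergence

section Regimes

variable {l : Filter ℕ} {κ : ℕ → ℕ} {q : ℝ≥0∞} {n k : ℕ}

/-- The regime of parameter `q ∈ [0, ∞]` along a filter `l` on `ℕ`, which is one of the three
regimes of the paper according to the position of `q` relative to `1`. General filters are allowed
so that ultrafilters are. -/
def MahonianRegime (l : Filter ℕ) (κ : ℕ → ℕ) (q : ℝ≥0∞) : Prop :=
  (q < 1 ∧ Tendsto (fun ν : ℕ => (κ ν : ℝ) / (ν : ℝ)) l (𝓝 (q.toReal / (1 - q.toReal)))) ∨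
  (1 < q ∧ Tendsto (fun ν : ℕ => ((ν.choose 2 : ℝ) - (κ ν : ℝ)) / (ν : ℝ)) l
    (𝓝 ((q⁻¹).toReal / (1 - (q⁻¹).toReal)))) ∨
  (q = 1 ∧ Tendsto (fun ν : ℕ => (κ ν : ℝ) / (ν : ℝ)) l atTop ∧
    Tendsto (fun ν : ℕ => ((ν.choose 2 : ℝ) - (κ ν : ℝ)) / (ν : ℝ)) l atTop)

/-- The ratios `M_{n,k}^{ν,κ(ν)} / M_{ν,κ(ν)}` tend to `L n k` along `l`, for all pairs
`(n, k) ∈ S`. This is `RatiosTendTo` with the range of `(n, k)` and the passage to the limit as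
parameters. -/
def RatiosTendToAlong (l : Filter ℕ) (S : Set (ℕ × ℕ)) (κ : ℕ → ℕ) (L : ℕ → ℕ → ℝ) : Prop :=
  ∀ n k : ℕ, (n, k) ∈ S → Tendsto (fun ν : ℕ => mahonianRatio n k ν (κ ν)) l (𝓝 (L n k))

lemma tendsto_mahonianRatio_of_lt_one (hl : l ≤ atTop) (hκ : ∀ᶠ ν in l, κ ν ≤ ν.choose 2)
    (hq : q < 1) (h : Tendsto (fun ν : ℕ => (κ ν : ℝ) / ν) l (𝓝 (q.toReal / (1 - q.toReal))))
    (hk : k ≤ n.choose 2) :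
    Tendsto (fun ν => mahonianRatio n k ν (κ ν)) l (𝓝 (mallowsMass q n k)) := by
  rw [mallowsMass_of_ne_top hq.ne_top]
  exact tendsto_mahonianRatio_of_linear hl hκ ENNReal.toReal_nonneg
    (ENNReal.toReal_lt_of_lt_ofReal (by rwa [ENNReal.ofReal_one])) h hk

theorem MahonianRegime.tendsto_mahonianRatio (hl : l ≤ atTop)
    (hκ : ∀ᶠ ν in l, κ ν ≤ ν.choose 2) (h : MahonianRegime l κ q) (hk : k ≤ n.choose 2) :
    Tendsto (fun ν => mahonianRatio n k ν (κ ν)) l (𝓝 (mallowsMass q n k)) := by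
  have hsub : (fun ν : ℕ => ((ν.choose 2 : ℝ) - (κ ν : ℝ)) / (ν : ℝ))
      =ᶠ[l] fun ν => ((ν.choose 2 - κ ν : ℕ) : ℝ) / (ν : ℝ) := by
    filter_upwards [hκ] with ν hν
    rw [Nat.cast_sub hν]
  rcases h with ⟨hq, h⟩ | ⟨hq, h⟩ | ⟨rfl, h, h'⟩
  · exact tendsto_mahonianRatio_of_lt_one hl hκ hq h hk
  · rw [← mallowsMass_inv q hk]
    exact (tendsto_mahonianRatio_of_lt_one hl (Eventually.of_forall fun ν => Nat.sub_le _ _)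
      (ENNReal.inv_lt_one.2 hq) (h.congr' hsub) (Nat.sub_le _ _)).congr'
      (eventually_mahonianRatio_reflect hl hκ hk)
  · rw [mallowsMass_of_ne_top ENNReal.one_ne_top, ENNReal.toReal_one]
    exact tendsto_mahonianRatio_of_superlinear hl hκ h (h'.congr' hsub) hk

lemma exists_mahonianRegime_ultrafilter (g : Ultrafilter ℕ)
    (hκ : ∀ᶠ ν in (g : Filter ℕ), κ ν ≤ ν.choose 2) : ∃ q, MahonianRegime g κ q := by
  have hnonneg : ∀ᶠ ν in (g : Filter ℕ), 0 ≤ ((ν.choose 2 : ℝ) - (κ ν : ℝ)) / (ν : ℝ) := by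
    filter_upwards [hκ] with ν hν
    exact div_nonneg (sub_nonneg.2 (Nat.cast_le.2 hν)) (Nat.cast_nonneg _)
  rcases exists_tendsto_or_tendsto_atTop g (u := fun ν : ℕ => (κ ν : ℝ) / (ν : ℝ))
    (Eventually.of_forall fun ν => by positivity) with ⟨t, ht, h⟩ | h
  · obtain ⟨q, hq, rfl⟩ := exists_lt_one_div_one_sub_eq ht
    exact ⟨q, Or.inl ⟨hq, h⟩⟩
  rcases exists_tendsto_or_tendsto_atTop g hnonneg with ⟨t, ht, h'⟩ | h'
  · obtain ⟨q, hq, rfl⟩ := exists_lt_one_div_one_sub_eq ht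
    exact ⟨q⁻¹, Or.inr (Or.inl ⟨ENNReal.one_lt_inv.2 hq, by rwa [inv_inv]⟩)⟩
  · exact ⟨1, Or.inr (Or.inr ⟨rfl, h, h'⟩)⟩

lemma MahonianRegime.of_ultrafilter (h : ∀ g : Ultrafilter ℕ, ↑g ≤ l → MahonianRegime g κ q) :
    MahonianRegime l κ q := by
  rcases lt_trichotomy q 1 with hq | rfl | hq
  · simp only [MahonianRegime, hq, hq.not_gt, hq.ne, true_and, false_and, or_false] at h ⊢
    exact (tendsto_iff_ultrafilter _ _ _).2 h
  · simp only [MahonianRegime, lt_irrefl, true_and, false_and, false_or] at h ⊢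
    exact ⟨(tendsto_iff_ultrafilter _ _ _).2 fun g hg => (h g hg).1,
      (tendsto_iff_ultrafilter _ _ _).2 fun g hg => (h g hg).2⟩
  · simp only [MahonianRegime, hq, hq.not_gt, hq.ne', true_and, false_and, or_false,
      false_or] at h ⊢
    exact (tendsto_iff_ultrafilter _ _ _).2 h

theorem exists_mahonianRegime_of_tendsto [l.NeBot] (hl : l ≤ atTop)
    (hκ : ∀ᶠ ν in l, κ ν ≤ ν.choose 2) {x : ℝ}
    (hx : Tendsto (fun ν => mahonianRatio 2 0 ν (κ ν)) l (𝓝 x)) :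
    ∃ q, x = mallowsMass q 2 0 ∧ MahonianRegime l κ q := by
  have hlimit : ∀ (g : Ultrafilter ℕ) (q : ℝ≥0∞), ↑g ≤ l → MahonianRegime g κ q →
      x = mallowsMass q 2 0 := fun g q hg h =>
    tendsto_nhds_unique (hx.mono_left hg)
      (h.tendsto_mahonianRatio (hg.trans hl) (hg hκ) (Nat.zero_le _))
  obtain ⟨q, hq⟩ := exists_mahonianRegime_ultrafilter (Ultrafilter.of l) (Ultrafilter.of_le l hκ)
  have hxq := hlimit _ q (Ultrafilter.of_le l) hq
  refine ⟨q, hxq, MahonianRegime.of_ultrafilter fun g hg => ?_⟩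
  obtain ⟨q', hq'⟩ := exists_mahonianRegime_ultrafilter g (hg hκ)
  rwa [mallowsMass_two_zero_injective (hxq.symm.trans (hlimit g q' hg hq'))]

theorem mahonianRegime_of_tendsto [l.NeBot] (hl : l ≤ atTop) (hκ : ∀ᶠ ν in l, κ ν ≤ ν.choose 2)
    (h : Tendsto (fun ν => mahonianRatio 2 0 ν (κ ν)) l (𝓝 (mallowsMass q 2 0))) :
    MahonianRegime l κ q := by
  obtain ⟨q', hqq', hq'⟩ := exists_mahonianRegime_of_tendsto hl hκ h
  rwa [mallowsMass_two_zero_injective hqq']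

end Regimes

theorem corollary1_general {l : Filter ℕ} [l.NeBot] (hl : l ≤ atTop) {κ : ℕ → ℕ}
    (hκ : ∀ᶠ ν in l, κ ν ≤ ν.choose 2) {S : Set (ℕ × ℕ)}
    (hS : ∀ n k, (n, k) ∈ S → k ≤ n.choose 2) (hS20 : (2, 0) ∈ S) :
    (∀ L, RatiosTendToAlong l S κ L → ∃ q, ∀ n k, (n, k) ∈ S → L n k = mallowsMass q n k) ∧
    ((∃ L, RatiosTendToAlong l S κ L) ↔ ∃ q, MahonianRegime l κ q) ∧
    ∀ q, RatiosTendToAlong l S κ (mallowsMass q) ↔ MahonianRegime l κ q := by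
  have hconv : ∀ q, MahonianRegime l κ q → RatiosTendToAlong l S κ (mallowsMass q) :=
    fun q h n k hnk => h.tendsto_mahonianRatio hl hκ (hS n k hnk)
  have hregime : ∀ L, RatiosTendToAlong l S κ L → ∃ q, MahonianRegime l κ q := fun L hL =>
    (exists_mahonianRegime_of_tendsto hl hκ (hL 2 0 hS20)).imp fun _ h => h.2
  refine ⟨fun L hL => ?_, ⟨fun ⟨L, hL⟩ => hregime L hL, fun ⟨q, hq⟩ => ⟨_, hconv q hq⟩⟩,
    fun q => ⟨fun h => mahonianRegime_of_tendsto hl hκ (h 2 0 hS20), hconv q⟩⟩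
  obtain ⟨q, hq⟩ := hregime L hL
  exact ⟨q, fun n k hnk => tendsto_nhds_unique (hL n k hnk) (hconv q hq n k hnk)⟩

theorem corollary1 (κ : ℕ → ℕ) (hκ : ∀ᶠ ν : ℕ in atTop, κ ν ≤ ν.choose 2) :
    -- if all the ratios converge, the limit is `q^k / [n]_q!` for some `q ∈ [0, ∞]`
    (∀ L : ℕ → ℕ → ℝ, RatiosTendTo κ L →
      ∃ q : ℝ≥0∞, ∀ n k : ℕ, 1 ≤ n → k ≤ n.choose 2 → L n k = mallowsMass q n k) ∧
    -- the ratios all converge if and only if `κ` is in one of the three regimes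
    ((∃ L : ℕ → ℕ → ℝ, RatiosTendTo κ L) ↔
      (∃ q : ℝ≥0∞, q < 1 ∧ LowRegime κ q) ∨ (∃ q : ℝ≥0∞, 1 < q ∧ HighRegime κ q) ∨
        SuperlinearRegime κ) ∧
    -- and the parameter `q` of the limit is the one of the regime
    (∀ q : ℝ≥0∞, RatiosTendTo κ (mallowsMass q) ↔
      (q < 1 ∧ LowRegime κ q) ∨ (1 < q ∧ HighRegime κ q) ∨ (q = 1 ∧ SuperlinearRegime κ)) := by
  simpa [RatiosTendToAlong, MahonianRegime, RatiosTendTo, LowRegime, HighRegime,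
    SuperlinearRegime, exists_or] using
    corollary1_general (S := {p | 1 ≤ p.1 ∧ p.2 ≤ p.1.choose 2}) le_rfl hκ (fun n k h => h.2)
      (by simp)
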